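/- **Setting.** Let $d\in\{2,3\}$ and let $\Omega\subset\mathbb R^d$ be a bounded polygonal/polyhedral domain (connected, open, $\operatorname{int}\overline\Omega=\Omega$, $\overline\Omega$ a finite conforming union of simplices). Let $\partial\Omega=\Gamma_D\cup\Gamma_N$ with $\Gamma_D,\Gamma_N$ closed, $|\Gamma_D\cap\Gamma_N|=0$, $|\Gamma_D|>0$. Let $\mu,\lambda,\kappa,\bar T>0$. Write $(\cdot,\cdot)$, $\|\cdot\|$ for the inner product and norm of $L^2(\Omega)$ (also for vectors and matrices), $|v|_1=\|\nabla v\|$, $\varepsilon(v)=\tfrac12(\nabla v+(\nabla v)^T)$, $H^1_{0,D}(\Omega)=\{v\in H^1(\Omega): v=0 \text{ on }\Gamma_D\}$, and $\langle\cdot,\cdot\rangle_{\Gamma_N}$ for the $L^2(\Gamma_N)$ pairing. For given $f(t)\in L^2(\Omega)^d$, $g(t)\in L^2(\Omega)$, $\beta(t)\in L^2(\Gamma_N)^d$, $\gamma(t)\in L^2(\Gamma_N)$ and initial data $\varphi,\phi$, let $u(t)\in[H^1_{0,D}(\Omega)]^d$, $q(t)\in L^2(\Omega)$, $p(t)\in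 H^1_{0,D}(\Omega)$ ($0\le t\le\bar T$), with $q,p\in H^1(0,\bar T;L^2(\Omega))$, solve $$\begin{aligned} 2\mu(\varepsilon(u),\varepsilon(v))-(q,\nabla\cdot v)&=(f,v)+\langle\beta,v\rangle_{\Gamma_N}&&\forall v\in[H^1_{0,D}(\Omega)]^d,\\ \lambda^{-1}(q-p,w)+(\nabla\cdot u,w)&=0&&\forall w\in L^2(\Omega),\\ -\lambda^{-1}(q_t-p_t,w)+\kappa(\nabla p,\nabla w)&=(g,w)+\langle\gamma,w\rangle_{\Gamma_N}&&\forall w\in H^1_{0,D}(\Omega), \end{aligned}$$ the first two equations for all $t\in(0,\bar T]$, the third for a.e. $t$, with $u(0)=\varphi$, $p(0)=\phi$, $q(0)=-\lambda\nabla\cdot\varphi+\phi$. For a conforming simplicial triangulation $\mathcal T_h$ of $\overline\Omega$ and fixed integers $k\ge2$, $l\ge0$ let $$\begin{aligned} U_h&=\{v\in[H^1_{0,D}(\Omega)]^d\cap[C^0(\Omega)]^d: v|_T\in[P_k(T)]^d\ \forall T\in\mathcal T_h\},\\ Z_h&=\{q\in L^2(\Omega): q|_T\in P_l(T)\ \forall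 T\in\mathcal T_h\},\\ P_h&=\{p\in H^1_{0,D}(\Omega)\cap C^0(\Omega): p|_T\in P_{k-1}(T)\ \forall T\in\mathcal T_h\}. \end{aligned}$$ For $t\in[0,\bar T]$ let $(Q_h^uu(t),Q_h^qq(t))\in U_h\times Z_h$ be the Stokes projection of $(u(t),q(t))$ and $Q_h^pp(t)\in P_h$ the elliptic projection of $p(t)$: $$\begin{aligned} 2\mu(\varepsilon(Q_h^uu),\varepsilon(v))-(Q_h^qq,\nabla\cdot v)&=2\mu(\varepsilon(u),\varepsilon(v))-(q,\nabla\cdot v)&&\forall v\in U_h,\\ (w,\nabla\cdot Q_h^uu)&=(w,\nabla\cdot u)&&\forall w\in Z_h,\\ (\nabla Q_h^pp,\nabla w)&=(\nabla p,\nabla w)&&\forall w\in P_h. \end{aligned}$$ Put $\eta_h^u=u-Q_h^uu$, $\eta_h^q=q-Q_h^qq$, $\eta_h^p=p-Q_h^pp$, where $\eta_h^q,\eta_h^p\in H^1(0,\bar T;L^2(\Omega))$ with time derivatives $\eta_{ht}^q,\eta_{ht}^p$. Let $u_h(t)\in U_h$, $q_h(t)\in Z_h$, $p_h(t)\in P_h$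 ($0\le t\le\bar T$), with $q_h,p_h\in H^1(0,\bar T;L^2(\Omega))$, be a solution of the semi-discrete scheme with initial values $u_h(0)=Q_h^uu(0)$, $q_h(0)=Q_h^qq(0)$, $p_h(0)=Q_h^pp(0)$: $$\begin{aligned} 2\mu(\varepsilon(u_h),\varepsilon(v))-(q_h,\nabla\cdot v)&=(f,v)+\langle\beta,v\rangle_{\Gamma_N}&&\forall v\in U_h,\\ \lambda^{-1}(q_h-p_h,w)+(\nabla\cdot u_h,w)&=0&&\forall w\in Z_h,\\ -\lambda^{-1}(q_{ht}-p_{ht},w)+\kappa(\nabla p_h,\nabla w)&=(g,w)+\langle\gamma,w\rangle_{\Gamma_N}&&\forall w\in P_h, \end{aligned}$$ the first two equations for all $t\in[0,\bar T]$ and the third for a.e. $t$. More generally, instead of the second equation it is enough that for each $w\in Z_h$ its left-hand side is constant in time (its time-differentiated form). Put $e_h^u=u-u_h$, $e_h^q=q-q_h$, $e_h^p=p-p_h$. **Theorem (semi-discrete error estimate).** Let $b>0$. There is a constant $C>0$, depending only on $\Omega,\Gamma_D,\Gamma_N,\mu,\lambda,\kappa,\bar T,b,k,l$ (in particular not on $\mathcal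 T_h$, its mesh size $h$, $t$, the data or the solutions), such that the following holds whenever $(U_h,Z_h)$ satisfies the discrete inf-sup condition $$\sup_{0\ne v\in U_h}\frac{(w,\nabla\cdot v)}{|v|_1}\ \ge\ b\,\|w\|\qquad\forall w\in Z_h .$$ For every $t\in(0,\bar T]$, $$\mu\|\varepsilon(e_h^u(t))\|^2+\|e_h^q(t)\|^2\le C\Big(\mu\|\varepsilon(\eta_h^u(t))\|^2+\|\eta_h^q(t)\|^2+\int_0^t\|\eta_{ht}^q-\eta_{ht}^p\|^2\,ds\Big)$$ and $$\kappa\|\nabla e_h^p(t)\|^2\le C\Big(\kappa\|\nabla\eta_h^p(t)\|^2+\int_0^t\|\eta_{ht}^q-\eta_{ht}^p\|^2\,ds\Big).$$ -/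

import Mathlib

open MeasureTheory Set Filter Topology
open scoped ENNReal ContDiff

noncomputable section

namespace Biot

/-- Euclidean space of dimension `d`. -/
abbrev Space (d : ℕ) : Type := EuclideanSpace ℝ (Fin d)

variable {d : ℕ}

/-! ### Geometry -/

/-- The surface measure on the boundary of `Ω`: the `(d-1)`-dimensional Hausdorff measure, normalised
so that it agrees with Lebesgue measure on `(d-1)`-planes, restricted to the boundary of `Ω`. -/
def surf (Ω : Set (Space d)) : Measure (Space d) := (μHE[d - 1]).restrict (frontier Ω)

/-- `K` is a finite conforming simplicial triangulation of the closure of `Ω`. -/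
structure IsTriangulation (Ω : Set (Space d)) (K : Geometry.SimplicialComplex ℝ (Space d)) :
    Prop where
  finite : K.faces.Finite
  space_eq : K.space = closure Ω

/-- Bounded polygonal (`d = 2`) or polyhedral (`d = 3`) domain: a bounded connected open set which lies
on one side of its boundary and whose closure is a finite union of conforming simplices. -/
structure IsPolyhedralDomain (Ω : Set (Space d)) : Prop where
  isOpen : IsOpen Ω
  isConnected : IsConnected Ω
  isBounded : Bornology.IsBounded Ω
  interior_closure : interior (closure Ω) = Ω
  polyhedral : ∃ K, IsTriangulation Ω K

/-- The boundary is split into closed parts `ΓD` and `ΓN` that overlap at most in a set of surface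
measure zero, and the Dirichlet part has positive surface measure. -/
structure IsBoundarySplitting (Ω ΓD ΓN : Set (Space d)) : Prop where
  isClosed_D : IsClosed ΓD
  isClosed_N : IsClosed ΓN
  union_eq : ΓD ∪ ΓN = frontier Ω
  null_inter : surf Ω (ΓD ∩ ΓN) = 0
  pos_D : 0 < surf Ω ΓD

/-! ### Function spaces -/

/-- The space `L²(Ω)`. -/
abbrev L2 (Ω : Set (Space d)) : Type := Lp ℝ 2 (volume.restrict Ω)

/-- The space `L²(∂Ω)`. -/
abbrev L2Bdry (Ω : Set (Space d)) : Type := Lp ℝ 2 (surf Ω)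

/-- Pairs `(v, G)` with `v ∈ L²(Ω)` and `G ∈ L²(Ω)^d`. A function of class `H¹` is represented by the
pair `(v, ∇v)`, see `H1`. -/
abbrev Jet (Ω : Set (Space d)) : Type := L2 Ω × (Fin d → L2 Ω)

/-- Vector-valued version of `Jet`: the `i`-th component of a vector field `v` is represented by
`((v i).1, (v i).2) = (vᵢ, ∇vᵢ)`. -/
abbrev VJet (Ω : Set (Space d)) : Type := Fin d → Jet Ω

/-- `g` is the weak partial derivative `∂ᵢ f` in `Ω`. -/
def IsWeakPartial (Ω : Set (Space d)) (i : Fin d) (f g : L2 Ω) : Prop :=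
  ∀ φ : Space d → ℝ, ContDiff ℝ ∞ φ → HasCompactSupport φ → tsupport φ ⊆ Ω →
    ∫ x in Ω, f x * fderiv ℝ φ x (EuclideanSpace.single i 1) = -∫ x in Ω, g x * φ x

/-- The Sobolev space `H¹(Ω)`, as the set of all pairs `(v, ∇v)`. -/
def H1 (Ω : Set (Space d)) : Set (Jet Ω) :=
  {v | ∀ i, IsWeakPartial Ω i v.1 (v.2 i)}

/-- `τ ∈ L²(∂Ω)` is the boundary trace of `v ∈ H¹(Ω)`: there are smooth functions on `ℝ^d` that converge
to `v` in `H¹(Ω)` and to `τ` in `L²(∂Ω)`. -/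
def IsTrace (Ω : Set (Space d)) (v : Jet Ω) (τ : L2Bdry Ω) : Prop :=
  ∃ φ : ℕ → Space d → ℝ, (∀ n, ContDiff ℝ ∞ (φ n)) ∧
    Tendsto (fun n => eLpNorm (fun x => φ n x - v.1 x) 2 (volume.restrict Ω)) atTop (𝓝 0) ∧
    (∀ i, Tendsto (fun n => eLpNorm
      (fun x => fderiv ℝ (φ n) x (EuclideanSpace.single i 1) - v.2 i x) 2 (volume.restrict Ω))
      atTop (𝓝 0)) ∧
    Tendsto (fun n => eLpNorm (fun x => φ n x - τ x) 2 (surf Ω)) atTop (𝓝 0)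

/-- The space `H¹_{0,D}(Ω)` of functions in `H¹(Ω)` whose trace vanishes on `ΓD`. -/
def H1D (Ω ΓD : Set (Space d)) : Set (Jet Ω) :=
  {v | v ∈ H1 Ω ∧ ∃ τ, IsTrace Ω v τ ∧ ∀ᵐ x ∂(surf Ω).restrict ΓD, τ x = 0}

/-- The space `[H¹_{0,D}(Ω)]^d`. -/
def VH1D (Ω ΓD : Set (Space d)) : Set (VJet Ω) := {v | ∀ i, v i ∈ H1D Ω ΓD}

/-! ### Bilinear forms and norms -/

variable {Ω : Set (Space d)}

/-- `(∇v, ∇w)`. -/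
def gradInner (v w : Jet Ω) : ℝ := ∑ i, inner ℝ (v.2 i) (w.2 i)

/-- `‖∇v‖²`. -/
def gradNormSq (v : Jet Ω) : ℝ := ∑ i, ‖v.2 i‖ ^ 2

/-- The strain `ε(v) = (∇v + (∇v)ᵀ) / 2`. -/
def strain (v : VJet Ω) (i j : Fin d) : L2 Ω := (2⁻¹ : ℝ) • ((v i).2 j + (v j).2 i)

/-- `(ε(v), ε(w))`. -/
def strainInner (v w : VJet Ω) : ℝ := ∑ i, ∑ j, inner ℝ (strain v i j) (strain w i j)

/-- `‖ε(v)‖²`. -/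
def strainNormSq (v : VJet Ω) : ℝ := ∑ i, ∑ j, ‖strain v i j‖ ^ 2

/-- The divergence of `v`. -/
def dvg (v : VJet Ω) : L2 Ω := ∑ i, (v i).2 i

/-- The seminorm `|v|₁ = ‖∇v‖`. -/
def seminorm1 (v : VJet Ω) : ℝ := √(∑ i, ∑ j, ‖(v i).2 j‖ ^ 2)

/-! ### Finite element spaces -/

/-- `v` restricted to each element (`d`-dimensional simplex) of `K` is a polynomial of total degree at
most `k`. -/
def IsPiecewisePoly (K : Geometry.SimplicialComplex ℝ (Space d)) (k : ℕ) (v : L2 Ω) : Prop :=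
  ∀ s ∈ K.faces, s.card = d + 1 → ∃ P : MvPolynomial (Fin d) ℝ, P.totalDegree ≤ k ∧
    ∀ᵐ x ∂volume.restrict (Ω ∩ convexHull ℝ (s : Set (Space d))),
      v x = MvPolynomial.eval (fun i => x i) P

/-- `v` has a representative that is continuous on `Ω`. -/
def HasContinuousRep (v : L2 Ω) : Prop :=
  ∃ f : Space d → ℝ, ContinuousOn f Ω ∧ ∀ᵐ x ∂volume.restrict Ω, v x = f x

/-- The space of continuous piecewise polynomials of degree at most `k` in `H¹_{0,D}(Ω)`. -/
def contFE (Ω ΓD : Set (Space d)) (K : Geometry.SimplicialComplex ℝ (Space d)) (k : ℕ) :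
    Set (Jet Ω) :=
  {v | v ∈ H1D Ω ΓD ∧ HasContinuousRep v.1 ∧ IsPiecewisePoly K k v.1}

/-- The displacement space `U_h`, of degree `k`. -/
def Uh (Ω ΓD : Set (Space d)) (K : Geometry.SimplicialComplex ℝ (Space d)) (k : ℕ) :
    Set (VJet Ω) :=
  {v | ∀ i, v i ∈ contFE Ω ΓD K k}

/-- The total stress space `Z_h`, of degree `l`. -/
def Zh (Ω : Set (Space d)) (K : Geometry.SimplicialComplex ℝ (Space d)) (l : ℕ) : Set (L2 Ω) :=
  {q | IsPiecewisePoly K l q}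

/-- The pressure space `P_h`, of degree `k - 1`. -/
def Ph (Ω ΓD : Set (Space d)) (K : Geometry.SimplicialComplex ℝ (Space d)) (k : ℕ) :
    Set (Jet Ω) :=
  contFE Ω ΓD K (k - 1)

/-- The inf-sup condition with constant `b` for a pair of spaces `(U, Z)`. -/
def InfSup (b : ℝ) (U : Set (VJet Ω)) (Z : Set (L2 Ω)) : Prop :=
  ∀ w ∈ Z, b * ‖w‖ ≤ sSup {r : ℝ | ∃ v ∈ U, v ≠ 0 ∧ r = inner ℝ w (dvg v) / seminorm1 v}

/-- `(Qu, Qq)` is the Stokes projection of `(u, q)` onto `U × Z`. -/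
structure IsStokesProjection (μ : ℝ) (U : Set (VJet Ω)) (Z : Set (L2 Ω))
    (u : VJet Ω) (q : L2 Ω) (Qu : VJet Ω) (Qq : L2 Ω) : Prop where
  mem_u : Qu ∈ U
  mem_q : Qq ∈ Z
  momentum : ∀ v ∈ U, 2 * μ * strainInner Qu v - inner ℝ Qq (dvg v)
    = 2 * μ * strainInner u v - inner ℝ q (dvg v)
  divergence : ∀ w ∈ Z, inner ℝ w (dvg Qu) = inner ℝ w (dvg u)

/-- `Qp` is the elliptic projection of `p` onto `P`. -/
structure IsEllipticProjection (P : Set (Jet Ω)) (p Qp : Jet Ω) : Prop where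
  mem : Qp ∈ P
  eq : ∀ w ∈ P, gradInner Qp w = gradInner p w

/-! ### Time-dependent problems -/

/-- `f ∈ H¹(0,T; X)` (continuous representative on `[0,T]`) with time derivative `f' ∈ L²(0,T; X)`. -/
structure HasTimeDeriv {X : Type*} [NormedAddCommGroup X] [NormedSpace ℝ X]
    (T : ℝ) (f f' : ℝ → X) : Prop where
  memLp : MemLp f' 2 (volume.restrict (Ioc 0 T))
  eq_integral : ∀ t ∈ Icc 0 T, f t = f 0 + ∫ s in (0 : ℝ)..t, f' s

/-- Data of the problem: body force `f`, source `g`, Neumann data `β`, `γ` on `ΓN`, and the initial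
displacement `u0` and pressure `p0`. -/
structure ProblemData (Ω ΓN : Set (Space d)) where
  f : ℝ → Fin d → L2 Ω
  g : ℝ → L2 Ω
  β : ℝ → Fin d → Lp ℝ 2 ((surf Ω).restrict ΓN)
  γ : ℝ → Lp ℝ 2 ((surf Ω).restrict ΓN)
  u0 : VJet Ω
  p0 : Jet Ω

variable {ΓN : Set (Space d)}

/-- `(f(t), v) + ⟨β(t), v⟩_{ΓN}`, where `τ` is the trace of `v`. -/
def ProblemData.momentumLoad (D : ProblemData Ω ΓN) (t : ℝ) (v : VJet Ω) (τ : Fin d → L2Bdry Ω) :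
    ℝ :=
  ∑ i, inner ℝ (D.f t i) (v i).1 + ∑ i, ∫ x, D.β t i x * τ i x ∂(surf Ω).restrict ΓN

/-- `(g(t), w) + ⟨γ(t), w⟩_{ΓN}`, where `τ` is the trace of `w`. -/
def ProblemData.massLoad (D : ProblemData Ω ΓN) (t : ℝ) (w : Jet Ω) (τ : L2Bdry Ω) : ℝ :=
  inner ℝ (D.g t) w.1 + ∫ x, D.γ t x * τ x ∂(surf Ω).restrict ΓN

/-- `(u, q, p)` is a solution of the three-field weak formulation on `[0,T]`; `qt` and `pt` are the time
derivatives of `q` and `p`. -/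
structure IsWeakSolution (ΓD : Set (Space d)) (μ lam κ T : ℝ) (D : ProblemData Ω ΓN)
    (u : ℝ → VJet Ω) (q qt : ℝ → L2 Ω) (p : ℝ → Jet Ω) (pt : ℝ → L2 Ω) : Prop where
  mem_u : ∀ t ∈ Icc 0 T, u t ∈ VH1D Ω ΓD
  mem_p : ∀ t ∈ Icc 0 T, p t ∈ H1D Ω ΓD
  deriv_q : HasTimeDeriv T q qt
  deriv_p : HasTimeDeriv T (fun t => (p t).1) pt
  momentum : ∀ t ∈ Ioc 0 T, ∀ v ∈ VH1D Ω ΓD, ∀ τ : Fin d → L2Bdry Ω, (∀ i, IsTrace Ω (v i) (τ i)) →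
    2 * μ * strainInner (u t) v - inner ℝ (q t) (dvg v) = D.momentumLoad t v τ
  coupling : ∀ t ∈ Ioc 0 T, ∀ w : L2 Ω,
    lam⁻¹ * inner ℝ (q t - (p t).1) w + inner ℝ (dvg (u t)) w = 0
  mass : ∀ᵐ t ∂volume.restrict (Ioc 0 T), ∀ w ∈ H1D Ω ΓD, ∀ τ : L2Bdry Ω, IsTrace Ω w τ →
    -(lam⁻¹ * inner ℝ (qt t - pt t) w.1) + κ * gradInner (p t) w = D.massLoad t w τ
  init_u : u 0 = D.u0
  init_q : q 0 = -(lam • dvg D.u0) + D.p0.1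
  init_p : p 0 = D.p0

/-- `(uh, qh, ph)` is a solution of the semi-discrete scheme in `U × Z × P` on `[0,T]`; `qht` and `pht`
are the time derivatives of `qh` and `ph`, and the initial values are `(uI, qI, pI)`.

The second equation is required up to its value at the initial time: a residual that is constant in
time is allowed. Triples for which the residual is zero are included. -/
structure IsSemidiscreteSolution (μ lam κ T : ℝ) (D : ProblemData Ω ΓN)
    (U : Set (VJet Ω)) (Z : Set (L2 Ω)) (P : Set (Jet Ω)) (uI : VJet Ω) (qI : L2 Ω) (pI : Jet Ω)
    (uh : ℝ → VJet Ω) (qh qht : ℝ → L2 Ω) (ph : ℝ → Jet Ω) (pht : ℝ → L2 Ω) : Prop where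
  mem_u : ∀ t ∈ Icc 0 T, uh t ∈ U
  mem_q : ∀ t ∈ Icc 0 T, qh t ∈ Z
  mem_p : ∀ t ∈ Icc 0 T, ph t ∈ P
  deriv_q : HasTimeDeriv T qh qht
  deriv_p : HasTimeDeriv T (fun t => (ph t).1) pht
  momentum : ∀ t ∈ Icc 0 T, ∀ v ∈ U, ∀ τ : Fin d → L2Bdry Ω, (∀ i, IsTrace Ω (v i) (τ i)) →
    2 * μ * strainInner (uh t) v - inner ℝ (qh t) (dvg v) = D.momentumLoad t v τ
  coupling : ∀ t ∈ Icc 0 T, ∀ w ∈ Z,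
    lam⁻¹ * inner ℝ (qh t - (ph t).1) w + inner ℝ (dvg (uh t)) w
      = lam⁻¹ * inner ℝ (qh 0 - (ph 0).1) w + inner ℝ (dvg (uh 0)) w
  mass : ∀ᵐ t ∂volume.restrict (Ioc 0 T), ∀ w ∈ P, ∀ τ : L2Bdry Ω, IsTrace Ω w τ →
    -(lam⁻¹ * inner ℝ (qht t - pht t) w.1) + κ * gradInner (ph t) w = D.massLoad t w τ
  init_u : uh 0 = uI
  init_q : qh 0 = qI
  init_p : ph 0 = pI

end Biot

end

open Biot

/-! Each error is a projection error plus a discrete error (projection minus semi-discrete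
solution). The projections cancel every consistency term except ρ = `ηqt - ηpt`, and all discrete
errors vanish at time 0. Write σ, θq, θp for the discrete errors of strain, total stress and
pressure. `energy_estimate` differentiates the coupling equation in time and tests it with θq', and
tests the mass equation with θp'. Since the momentum equation determines σ linearly from θq, this
yields, with a = θq' - θp', κ (∇θp, ∇θp') + 2μ ‖σ'‖² = -lam⁻¹ (a + ρ, a) ≤ (lam⁻¹/4) ‖ρ‖².
Integration bounds ∇θp(t) and ∫ ‖σ'‖²; Cauchy-Schwarz in time then bounds σ(t), and `InfSup.norm_le`
bounds θq(t) by σ(t). No Gronwall argument is needed. Only strains occur, so Korn's inequality is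
not needed either. Time regularity is given only for q and p as `L²` functions. Finite dimension of
the discrete spaces transfers it to strains and gradients through bounded linear maps. -/

noncomputable section

namespace Biot

/-! ### Calculus of time-dependent functions -/

section TimeDerivative

variable {X Y : Type*} [NormedAddCommGroup X] [NormedSpace ℝ X]
  [NormedAddCommGroup Y] [NormedSpace ℝ Y] {T : ℝ} {f f' g g' : ℝ → X}

lemma intervalIntegrable_of_memLp {E : Type*} [NormedAddCommGroup E] {T : ℝ} {φ : ℝ → E}
    (hf : MemLp φ 2 (volume.restrict (Ioc 0 T))) {a b : ℝ}
    (ha : a ∈ Icc 0 T) (hb : b ∈ Icc 0 T) : IntervalIntegrable φ volume a b := by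
  have h : IntegrableOn φ (Ioc 0 T) := hf.integrable (by norm_num)
  refine (intervalIntegrable_iff.2 (h.mono_set ?_))
  exact Ioc_subset_Ioc (le_min ha.1 hb.1) (max_le ha.2 hb.2)

lemma intervalIntegrable_norm_sq_of_memLp {E : Type*} [NormedAddCommGroup E] {T : ℝ} {φ : ℝ → E}
    (hf : MemLp φ 2 (volume.restrict (Ioc 0 T))) {a b : ℝ}
    (ha : a ∈ Icc 0 T) (hb : b ∈ Icc 0 T) :
    IntervalIntegrable (fun s => ‖φ s‖ ^ 2) volume a b := by
  have h : IntegrableOn (fun s => ‖φ s‖ ^ 2) (Ioc 0 T) := hf.integrable_norm_pow two_ne_zero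
  refine (intervalIntegrable_iff.2 (h.mono_set ?_))
  exact Ioc_subset_Ioc (le_min ha.1 hb.1) (max_le ha.2 hb.2)

namespace HasTimeDeriv

lemma intervalIntegrable (hf : HasTimeDeriv T f f') {a b : ℝ} (ha : a ∈ Icc 0 T)
    (hb : b ∈ Icc 0 T) : IntervalIntegrable f' volume a b :=
  intervalIntegrable_of_memLp hf.memLp ha hb

lemma sub (hf : HasTimeDeriv T f f') (hg : HasTimeDeriv T g g') :
    HasTimeDeriv T (fun t => f t - g t) (fun t => f' t - g' t) where
  memLp := hf.memLp.sub hg.memLp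
  eq_integral t ht := by
    have h0 : (0 : ℝ) ∈ Icc 0 T := ⟨le_rfl, ht.1.trans ht.2⟩
    rw [intervalIntegral.integral_sub (hf.intervalIntegrable h0 ht) (hg.intervalIntegrable h0 ht),
      hf.eq_integral t ht, hg.eq_integral t ht]
    abel

lemma congr (hf : HasTimeDeriv T f f') (h : ∀ t ∈ Icc 0 T, g t = f t) : HasTimeDeriv T g f' where
  memLp := hf.memLp
  eq_integral t ht := by
    rw [h t ht, h 0 ⟨le_rfl, ht.1.trans ht.2⟩, hf.eq_integral t ht]

lemma clm [CompleteSpace X] [CompleteSpace Y] (hf : HasTimeDeriv T f f') (L : X →L[ℝ] Y) :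
    HasTimeDeriv T (fun t => L (f t)) (fun t => L (f' t)) where
  memLp := L.comp_memLp' hf.memLp
  eq_integral t ht := by
    have h0 : (0 : ℝ) ∈ Icc 0 T := ⟨le_rfl, ht.1.trans ht.2⟩
    rw [L.intervalIntegral_comp_comm (hf.intervalIntegrable h0 ht), ← map_add,
      ← hf.eq_integral t ht]

lemma ae_hasDerivAt [CompleteSpace X] (hf : HasTimeDeriv T f f') :
    ∀ᵐ t ∂volume.restrict (Ioc 0 T), HasDerivAt f (f' t) t := by
  rcases le_or_gt T 0 with hT | hT
  · simp [Ioc_eq_empty_of_le hT]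
  have h0 : (0 : ℝ) ∈ Icc 0 T := ⟨le_rfl, hT.le⟩
  have hT' : T ∈ Icc 0 T := ⟨hT.le, le_rfl⟩
  -- `f` equals its primitive only on `[0,T]`, so the two-sided derivative at the endpoint `T` has
  -- to be discarded.
  have hne : ∀ᵐ x : ℝ, x ≠ T := by simp [ae_iff, measure_singleton]
  rw [ae_restrict_iff' measurableSet_Ioc]
  filter_upwards [(hf.intervalIntegrable h0 hT').ae_hasDerivAt_integral, hne] with t ht htT hmem
  rw [uIcc_of_le hT.le] at ht
  have h := (ht (Ioc_subset_Icc_self hmem) 0 h0).const_add (f 0)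
  refine h.congr_of_eventuallyEq ?_
  filter_upwards [Ioo_mem_nhds hmem.1 (lt_of_le_of_ne hmem.2 htT)] with s hs
  exact hf.eq_integral s (Ioo_subset_Icc_self hs)

/-- Cauchy-Schwarz in time, obtained from the nonnegative variance of `‖f'‖` about its mean `A / t`.
-/
lemma norm_sq_le [CompleteSpace X] (hf : HasTimeDeriv T f f') (h0 : f 0 = 0) {t : ℝ}
    (ht : t ∈ Ioc 0 T) : ‖f t‖ ^ 2 ≤ t * ∫ s in (0 : ℝ)..t, ‖f' s‖ ^ 2 := by
  have hz : (0 : ℝ) ∈ Icc 0 T := ⟨le_rfl, ht.1.le.trans ht.2⟩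
  have ht' := Ioc_subset_Icc_self ht
  have hi := (hf.intervalIntegrable hz ht').norm
  have hi2 := intervalIntegrable_norm_sq_of_memLp hf.memLp hz ht'
  set A := ∫ s in (0 : ℝ)..t, ‖f' s‖ with hA
  have h1 : ‖f t‖ ≤ A := by
    rw [hf.eq_integral t ht', h0, zero_add]
    exact intervalIntegral.norm_integral_le_integral_norm ht.1.le
  have h2 : 0 ≤ ∫ s in (0 : ℝ)..t, (‖f' s‖ - A / t) ^ 2 :=
    intervalIntegral.integral_nonneg ht.1.le fun s _ => sq_nonneg _
  have h3 : ∫ s in (0 : ℝ)..t, (‖f' s‖ - A / t) ^ 2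
      = (∫ s in (0 : ℝ)..t, ‖f' s‖ ^ 2) - 2 * (A / t) * A + (A / t) ^ 2 * t := by
    have : ∀ s, (‖f' s‖ - A / t) ^ 2 = ‖f' s‖ ^ 2 - 2 * (A / t) * ‖f' s‖ + (A / t) ^ 2 := by
      intro s; ring
    simp_rw [this]
    rw [intervalIntegral.integral_add (hi2.sub (hi.const_mul _)) (by simp),
      intervalIntegral.integral_sub hi2 (hi.const_mul _), intervalIntegral.integral_const_mul]
    simp [hA]
    ring
  have h4 : ‖f t‖ ^ 2 ≤ A ^ 2 := by gcongr
  have ht0 : t ≠ 0 := ht.1.ne'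
  have h5 : t * ((∫ s in (0 : ℝ)..t, ‖f' s‖ ^ 2) - 2 * (A / t) * A + (A / t) ^ 2 * t)
      = t * (∫ s in (0 : ℝ)..t, ‖f' s‖ ^ 2) - A ^ 2 := by field_simp; ring
  have := mul_nonneg ht.1.le (h3 ▸ h2)
  linarith

end HasTimeDeriv

lemma absolutelyContinuousOnInterval_of_dist_le {X Y : Type*} [PseudoMetricSpace X]
    [PseudoMetricSpace Y] {f : ℝ → X} {g : ℝ → Y} {a b : ℝ}
    (hg : AbsolutelyContinuousOnInterval g a b)
    (h : ∀ x ∈ uIcc a b, ∀ y ∈ uIcc a b, dist (f x) (f y) ≤ dist (g x) (g y)) :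
    AbsolutelyContinuousOnInterval f a b := by
  refine squeeze_zero' (Eventually.of_forall fun E => Finset.sum_nonneg fun _ _ => dist_nonneg)
    ?_ hg
  filter_upwards [mem_inf_of_right (mem_principal_self _)] with E hE
  exact Finset.sum_le_sum fun i hi => h _ (hE.1 i hi).1 _ (hE.1 i hi).2

/-- The increments of `f` are dominated by those of the primitive Φ of `‖f'‖`, and `f` is bounded by
some `M`. So `‖f‖²` is dominated by `2MΦ`, is absolutely continuous, and the fundamental theorem of
calculus applies to its a.e. derivative. -/
lemma HasTimeDeriv.norm_sq_eq {H : Type*} [NormedAddCommGroup H] [InnerProductSpace ℝ H]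
    [CompleteSpace H] {T : ℝ} {f f' : ℝ → H} (hf : HasTimeDeriv T f f') (h0 : f 0 = 0) {t : ℝ}
    (ht : t ∈ Icc 0 T) : ‖f t‖ ^ 2 = 2 * ∫ s in (0 : ℝ)..t, inner ℝ (f s) (f' s) := by
  have hz : (0 : ℝ) ∈ Icc 0 T := ⟨le_rfl, ht.1.trans ht.2⟩
  have hsub : uIcc 0 t ⊆ Icc 0 T := by
    rw [uIcc_of_le ht.1]; exact Icc_subset_Icc_right ht.2
  have hi := hf.intervalIntegrable hz ht
  have hin : ∀ x ∈ uIcc 0 t, ∀ y ∈ uIcc 0 t, IntervalIntegrable f' volume x y :=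
    fun x hx y hy => hf.intervalIntegrable (hsub hx) (hsub hy)
  set Φ : ℝ → ℝ := fun x => ∫ s in (0 : ℝ)..x, ‖f' s‖ with hΦ
  have hΦac : AbsolutelyContinuousOnInterval Φ 0 t :=
    hi.norm.absolutelyContinuousOnInterval_intervalIntegral (by simp)
  have hdist : ∀ x ∈ uIcc 0 t, ∀ y ∈ uIcc 0 t, ‖f x - f y‖ ≤ |Φ x - Φ y| := by
    intro x hx y hy
    have e1 : f x - f y = ∫ s in y..x, f' s := by
      rw [hf.eq_integral x (hsub hx), hf.eq_integral y (hsub hy), add_sub_add_left_eq_sub,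
        intervalIntegral.integral_interval_sub_left (hin _ (by simp) _ hx) (hin _ (by simp) _ hy)]
    have e2 : Φ x - Φ y = ∫ s in y..x, ‖f' s‖ :=
      intervalIntegral.integral_interval_sub_left (hin _ (by simp) _ hx).norm
        (hin _ (by simp) _ hy).norm
    rw [e1, e2]
    exact intervalIntegral.norm_integral_le_abs_integral_norm
  obtain ⟨M, hM⟩ := hΦac.exists_bound
  have hfM : ∀ x ∈ uIcc 0 t, ‖f x‖ ≤ M := by
    intro x hx
    have := hdist x hx 0 (by simp)
    rw [h0, sub_zero] at this
    refine this.trans ?_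
    simpa [hΦ] using hM x hx
  have hac : AbsolutelyContinuousOnInterval (fun x => ‖f x‖ ^ 2) 0 t := by
    refine absolutelyContinuousOnInterval_of_dist_le (hΦac.const_mul (2 * M)) ?_
    intro x hx y hy
    have hM0 : 0 ≤ M := (norm_nonneg _).trans (hfM x hx)
    rw [Real.dist_eq, Real.dist_eq, ← mul_sub, abs_mul, abs_of_nonneg (by positivity : 0 ≤ 2 * M),
      sq_sub_sq, abs_mul]
    have h1 : |‖f x‖ + ‖f y‖| ≤ 2 * M := by
      rw [abs_of_nonneg (by positivity)]
      linarith [hfM x hx, hfM y hy]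
    exact mul_le_mul h1 ((abs_norm_sub_norm_le _ _).trans (hdist x hx y hy)) (abs_nonneg _)
      (by positivity)
  have key := hac.integral_deriv_eq_sub
  rw [h0, norm_zero, zero_pow two_ne_zero, sub_zero] at key
  rw [← key, ← intervalIntegral.integral_const_mul]
  refine intervalIntegral.integral_congr_ae ?_
  have := (ae_restrict_iff' measurableSet_Ioc).1 hf.ae_hasDerivAt
  filter_upwards [this] with s hs hs'
  rw [uIoc_of_le ht.1] at hs'
  have := (hs ⟨hs'.1, hs'.2.trans ht.2⟩).norm_sq
  exact this.deriv

end TimeDerivative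

/-! ### Abstract error equations -/

section ErrorEquations

variable {H M N J : Type*} [NormedAddCommGroup H] [InnerProductSpace ℝ H]
  [NormedAddCommGroup M] [InnerProductSpace ℝ M] [CompleteSpace M]
  [NormedAddCommGroup N] [InnerProductSpace ℝ N] [CompleteSpace N]
  [NormedAddCommGroup J] [NormedSpace ℝ J]

/-- A continuous linear map that is injective on a finite-dimensional subspace `P` has a continuous
left inverse on `P`. -/
lemma exists_continuous_leftInverse (P : Submodule ℝ J) [FiniteDimensional ℝ P] (π : J →L[ℝ] H)
    (hπ : ∀ v ∈ P, π v = 0 → v = 0) :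
    ∃ A : H →L[ℝ] J, (∀ w, A w ∈ P) ∧ ∀ v ∈ P, A (π v) = v := by
  let φ : P →ₗ[ℝ] H := π.toLinearMap ∘ₗ P.subtype
  have hφ : LinearMap.ker φ = ⊥ := by
    rw [LinearMap.ker_eq_bot']
    intro v hv
    exact Subtype.ext (hπ v v.2 hv)
  obtain ⟨L, hL⟩ := φ.exists_leftInverse_of_injective hφ
  let V : Submodule ℝ H := LinearMap.range φ
  let A : H →L[ℝ] P := (LinearMap.toContinuousLinearMap (L ∘ₗ V.subtype)) ∘L
    V.orthogonalProjectionOnto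
  refine ⟨P.subtypeL ∘L A, fun w => (A w).2, fun v hv => ?_⟩
  have h1 : φ ⟨v, hv⟩ ∈ V := ⟨_, rfl⟩
  have h2 : V.orthogonalProjectionOnto (π v) = ⟨φ ⟨v, hv⟩, h1⟩ :=
    V.orthogonalProjectionOnto_mem_subspace_eq_self ⟨φ ⟨v, hv⟩, h1⟩
  have h3 : L (φ ⟨v, hv⟩) = ⟨v, hv⟩ := LinearMap.congr_fun hL ⟨v, hv⟩
  simp [A, h2, h3]

/-- The energy estimate for the error equations of a semi-discrete three-field scheme: `σ`, `θq`, `θp`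
are the discrete errors of the strain, the total stress and the pressure, and `ρ` is the
consistency error. -/
theorem energy_estimate [CompleteSpace H] {μ lam κ T : ℝ} (hμ : 0 < μ) (hlam : 0 < lam)
    (Z : Submodule ℝ H) [FiniteDimensional ℝ Z] (S : Submodule ℝ M) [FiniteDimensional ℝ S]
    (P : Submodule ℝ J) [FiniteDimensional ℝ P]
    (tr : M →L[ℝ] H) (π : J →L[ℝ] H) (grad : J →L[ℝ] N) (hπ : ∀ v ∈ P, π v = 0 → v = 0)
    {σ : ℝ → M} {θq θqt θpt ρ : ℝ → H} {θp : ℝ → J}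
    (hσ : ∀ t ∈ Icc 0 T, σ t ∈ S) (hq : ∀ t ∈ Icc 0 T, θq t ∈ Z) (hp : ∀ t ∈ Icc 0 T, θp t ∈ P)
    (hq0 : θq 0 = 0) (hp0 : θp 0 = 0)
    (hqt : HasTimeDeriv T θq θqt) (hpt : HasTimeDeriv T (fun t => π (θp t)) θpt)
    (hρ : MemLp ρ 2 (volume.restrict (Ioc 0 T)))
    (momentum : ∀ t ∈ Icc 0 T, ∀ τ ∈ S, 2 * μ * inner ℝ (σ t) τ = inner ℝ (θq t) (tr τ))
    (coupling : ∀ t ∈ Icc 0 T, ∀ w ∈ Z,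
      lam⁻¹ * inner ℝ (θq t - π (θp t) + ∫ s in (0 : ℝ)..t, ρ s) w + inner ℝ (tr (σ t)) w = 0)
    (mass : ∀ᵐ t ∂volume.restrict (Ioc 0 T), ∀ w ∈ P,
      lam⁻¹ * inner ℝ (θqt t - θpt t + ρ t) (π w) = κ * inner ℝ (grad (θp t)) (grad w))
    {t : ℝ} (ht : t ∈ Ioc 0 T) :
    κ * ‖grad (θp t)‖ ^ 2 ≤ lam⁻¹ / 2 * (∫ s in (0 : ℝ)..t, ‖ρ s‖ ^ 2) ∧
      (0 ≤ κ → μ * ‖σ t‖ ^ 2 ≤ T * lam⁻¹ / 8 * ∫ s in (0 : ℝ)..t, ‖ρ s‖ ^ 2) := by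
  obtain ⟨A, hAP, hA⟩ := exists_continuous_leftInverse P π hπ
  have hz : (0 : ℝ) ∈ Icc 0 T := ⟨le_rfl, ht.1.le.trans ht.2⟩
  have ht' := Ioc_subset_Icc_self ht
  -- `B` is the solution operator of the momentum equation: the representative in `S` of the
  -- functional `τ ↦ (w, tr τ) / (2μ)`.
  let B : H →L[ℝ] M := (2 * μ)⁻¹ • (S.starProjection ∘L tr.adjoint)
  have hBS : ∀ w, B w ∈ S := fun w => S.smul_mem _ (S.starProjection_apply_mem _)
  have hB : ∀ w, ∀ τ ∈ S, 2 * μ * inner ℝ (B w) τ = inner ℝ w (tr τ) := by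
    intro w τ hτ
    have h1 : inner ℝ (S.starProjection (tr.adjoint w)) τ = inner ℝ w (tr τ) := by
      rw [S.inner_starProjection_left_eq_right, S.starProjection_eq_self_iff.2 hτ,
        ContinuousLinearMap.adjoint_inner_left]
    simp only [B, smul_apply, ContinuousLinearMap.comp_apply,
      inner_smul_left, h1]
    simp
    field_simp
  have hσB : ∀ s ∈ Icc 0 T, σ s = B (θq s) := by
    intro s hs
    have h1 : σ s - B (θq s) ∈ S := S.sub_mem (hσ s hs) (hBS _)
    have h2 := momentum s hs _ h1
    rw [← hB (θq s) _ h1] at h2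
    have h3 : inner ℝ (σ s - B (θq s)) (σ s - B (θq s)) = 0 := by
      rw [inner_sub_left, sub_eq_zero]
      exact mul_left_cancel₀ (by positivity) h2
    exact sub_eq_zero.1 (inner_self_eq_zero.1 h3)
  -- No time regularity of σ is assumed; it is inherited from θq through `B`, and that of the
  -- gradient from `π θp` through `grad ∘ A`.
  have hσt : HasTimeDeriv T σ (fun s => B (θqt s)) := (hqt.clm B).congr hσB
  have hgt : HasTimeDeriv T (fun s => grad (θp s)) (fun s => grad (A (θpt s))) :=
    (hpt.clm (grad ∘L A)).congr fun s hs => by simp [hA _ (hp s hs)]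
  have hRt : HasTimeDeriv T (fun t => ∫ s in (0 : ℝ)..t, ρ s) ρ := ⟨hρ, by simp⟩
  have hne : ∀ᵐ x ∂volume.restrict (Ioc 0 T), x ≠ T :=
    ae_restrict_of_ae (by simp [ae_iff, measure_singleton])
  have key : ∀ᵐ s ∂volume.restrict (Ioc 0 T),
      κ * inner ℝ (grad (θp s)) (grad (A (θpt s))) + 2 * μ * ‖B (θqt s)‖ ^ 2
        ≤ lam⁻¹ / 4 * ‖ρ s‖ ^ 2 := by
    filter_upwards [hqt.ae_hasDerivAt, hpt.ae_hasDerivAt, hRt.ae_hasDerivAt, hσt.ae_hasDerivAt,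
      mass, hne, ae_restrict_mem measurableSet_Ioc] with s dq dp dR dσ hm hsT hs
    have hnhds : ∀ᶠ r in 𝓝 s, r ∈ Icc 0 T := by
      filter_upwards [Ioo_mem_nhds hs.1 (lt_of_le_of_ne hs.2 hsT)] with r hr
      exact Ioo_subset_Icc_self hr
    -- The projection onto `Z` fixes θq near `s`, hence fixes its derivative; this makes `θqt s` an
    -- admissible test function. The same device gives `hAc`.
    have haZ : θqt s ∈ Z := by
      rw [← Z.starProjection_eq_self_iff]
      refine HasDerivAt.unique ((Z.starProjection.hasFDerivAt (x := θq s)).comp_hasDerivAt s dq) ?_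
      refine dq.congr_of_eventuallyEq ?_
      filter_upwards [hnhds] with r hr
      exact Z.starProjection_eq_self_iff.2 (hq r hr)
    have hAc : π (A (θpt s)) = θpt s := by
      refine HasDerivAt.unique
        (HasFDerivAt.comp_hasDerivAt (f := fun r => π (θp r)) s (π ∘L A).hasFDerivAt dp) ?_
      refine dp.congr_of_eventuallyEq ?_
      filter_upwards [hnhds] with r hr
      simp [hA _ (hp r hr)]
    have hc : lam⁻¹ * inner ℝ (θqt s - θpt s + ρ s) (θqt s)
        + inner ℝ (tr (B (θqt s))) (θqt s) = 0 := by
      -- The test vector is frozen at `θqt s` while the coupling equation is differentiated.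
      have h1 := ((dq.sub dp).add dR).inner ℝ (hasDerivAt_const s (θqt s))
      have h2 := ((tr.hasFDerivAt (x := σ s)).comp_hasDerivAt s dσ).inner ℝ
        (hasDerivAt_const s (θqt s))
      have h3 := (h1.const_mul lam⁻¹).add h2
      simp only [inner_zero_right, zero_add] at h3
      refine h3.unique ((hasDerivAt_const s (0 : ℝ)).congr_of_eventuallyEq ?_)
      filter_upwards [hnhds] with r hr
      exact coupling r hr _ haZ
    -- The exceptional null set in `mass` is chosen before `w`, so the test function may depend on
    -- `s`.
    have h1 := hm _ (hAP (θpt s))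
    rw [hAc] at h1
    have h2 := hB (θqt s) _ (hBS (θqt s))
    rw [real_inner_self_eq_norm_sq, real_inner_comm] at h2
    rw [← h1, h2]
    -- Completing the square: `-‖a‖² - (ρ, a) = ‖ρ‖²/4 - ‖a + ρ/2‖²` with `a = θqt - θpt`.
    have h3 : 0 ≤ ‖(θqt s - θpt s) + (2 : ℝ)⁻¹ • ρ s‖ ^ 2 := sq_nonneg _
    rw [norm_add_sq_real, norm_smul, inner_smul_right] at h3
    rw [eq_neg_of_add_eq_zero_right hc, ← sub_eq_add_neg, ← mul_sub, ← inner_sub_right]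
    have h4 : inner ℝ (θqt s - θpt s + ρ s) (θpt s - θqt s) ≤ 1 / 4 * ‖ρ s‖ ^ 2 := by
      rw [← neg_sub (θqt s) (θpt s), inner_neg_right, inner_add_left,
        real_inner_comm _ (ρ s), real_inner_self_eq_norm_sq]
      norm_num at h3
      nlinarith [h3]
    calc _ ≤ lam⁻¹ * (1 / 4 * ‖ρ s‖ ^ 2) := by gcongr
      _ = _ := by ring
  have hI1 := intervalIntegrable_norm_sq_of_memLp hσt.memLp hz ht'
  have hI2 := intervalIntegrable_norm_sq_of_memLp hρ hz ht'
  have hcont : ContinuousOn (fun s => grad (θp s)) (uIcc 0 t) := by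
    have h1 : ContinuousOn (fun s => ∫ r in (0 : ℝ)..s, grad (A (θpt r))) (uIcc 0 t) :=
      intervalIntegral.continuousOn_primitive_interval'
        (hgt.intervalIntegrable hz ht') (by simp)
    refine h1.congr fun s hs => ?_
    rw [uIcc_of_le ht.1.le] at hs
    have := hgt.eq_integral s ⟨hs.1, hs.2.trans ht.2⟩
    simpa [hp0] using this
  -- A bounded continuous factor times an integrable one.
  have hI3 : IntervalIntegrable (fun s => inner ℝ (grad (θp s)) (grad (A (θpt s)))) volume 0 t := by
    obtain ⟨M, hM⟩ := isCompact_uIcc.exists_bound_of_continuousOn hcont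
    have hi := hgt.intervalIntegrable hz ht'
    refine (hi.norm.const_mul M).mono_fun' ?_ ?_
    · exact ((hcont.mono uIoc_subset_uIcc).aestronglyMeasurable measurableSet_uIoc).inner
        hi.aestronglyMeasurable_restrict_uIoc
    · filter_upwards [ae_restrict_mem measurableSet_uIoc] with s hs
      refine (norm_inner_le_norm _ _).trans ?_
      gcongr
      exact hM s (uIoc_subset_uIcc hs)
  have hint : κ * (∫ s in (0 : ℝ)..t, inner ℝ (grad (θp s)) (grad (A (θpt s))))
      + 2 * μ * (∫ s in (0 : ℝ)..t, ‖B (θqt s)‖ ^ 2)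
      ≤ lam⁻¹ / 4 * ∫ s in (0 : ℝ)..t, ‖ρ s‖ ^ 2 := by
    rw [← intervalIntegral.integral_const_mul, ← intervalIntegral.integral_const_mul,
      ← intervalIntegral.integral_const_mul,
      ← intervalIntegral.integral_add (hI3.const_mul _) (hI1.const_mul _)]
    refine intervalIntegral.integral_mono_ae_restrict ht.1.le
      ((hI3.const_mul _).add (hI1.const_mul _)) (hI2.const_mul _) ?_
    have h1 : ∀ᵐ s ∂volume.restrict (Ioc 0 t), _ :=
      ae_mono (Measure.restrict_mono (Ioc_subset_Ioc_right ht.2) le_rfl) key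
    rw [restrict_Ioc_eq_restrict_Icc] at h1
    exact h1
  have hg := hgt.norm_sq_eq (by simp [hp0]) ht'
  have hs0 : σ 0 = 0 := by rw [hσB 0 hz, hq0, map_zero]
  have hs := hσt.norm_sq_le hs0 ht
  have hIB : 0 ≤ ∫ s in (0 : ℝ)..t, ‖B (θqt s)‖ ^ 2 :=
    intervalIntegral.integral_nonneg ht.1.le fun s _ => sq_nonneg _
  -- Each bound drops the other nonnegative term of `hint`.
  constructor
  · rw [hg]
    have := mul_nonneg hμ.le hIB
    linarith
  · intro hκ
    have h1 : 0 ≤ κ * ‖grad (θp t)‖ ^ 2 := by positivity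
    rw [hg] at h1
    have h2 : μ * (∫ s in (0 : ℝ)..t, ‖B (θqt s)‖ ^ 2)
        ≤ lam⁻¹ / 8 * ∫ s in (0 : ℝ)..t, ‖ρ s‖ ^ 2 := by linarith
    calc μ * ‖σ t‖ ^ 2 ≤ μ * (t * ∫ s in (0 : ℝ)..t, ‖B (θqt s)‖ ^ 2) := by gcongr
      _ = t * (μ * ∫ s in (0 : ℝ)..t, ‖B (θqt s)‖ ^ 2) := by ring
      _ ≤ T * (lam⁻¹ / 8 * ∫ s in (0 : ℝ)..t, ‖ρ s‖ ^ 2) :=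
        mul_le_mul ht.2 h2 (mul_nonneg hμ.le hIB) (ht.1.le.trans ht.2)
      _ = _ := by ring

end ErrorEquations

section FunctionSpaces

variable {d : ℕ} {Ω ΓD : Set (Space d)} {K : Geometry.SimplicialComplex ℝ (Space d)}

/-! ### Linear structure of the function spaces -/

lemma integrable_lp_mul_of_hasCompactSupport (f : L2 Ω) {g : Space d → ℝ} (hg : Continuous g)
    (hg' : HasCompactSupport g) : Integrable (fun x => f x * g x) (volume.restrict Ω) :=
  (Lp.memLp f).integrable_mul (q := 2) (hg.memLp_of_hasCompactSupport hg')

lemma continuous_fderiv_apply {φ : Space d → ℝ} (hφ : ContDiff ℝ ∞ φ) (e : Space d) :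
    Continuous fun x => fderiv ℝ φ x e :=
  (hφ.continuous_fderiv (by simp)).clm_apply continuous_const

lemma IsWeakPartial.add {i : Fin d} {f g f' g' : L2 Ω} (h : IsWeakPartial Ω i f g)
    (h' : IsWeakPartial Ω i f' g') : IsWeakPartial Ω i (f + f') (g + g') := by
  intro φ hφ hc hs
  have hD := continuous_fderiv_apply hφ (EuclideanSpace.single i 1)
  have hDc : HasCompactSupport fun x => fderiv ℝ φ x (EuclideanSpace.single i 1) :=
    hc.fderiv_apply (𝕜 := ℝ) _
  have e1 : ∫ x in Ω, (f + f') x * fderiv ℝ φ x (EuclideanSpace.single i 1)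
      = ∫ x in Ω, (f x * fderiv ℝ φ x (EuclideanSpace.single i 1)
        + f' x * fderiv ℝ φ x (EuclideanSpace.single i 1)) := by
    refine integral_congr_ae ?_
    filter_upwards [Lp.coeFn_add f f'] with x hx
    rw [hx, Pi.add_apply, add_mul]
  have e2 : ∫ x in Ω, (g + g') x * φ x = ∫ x in Ω, (g x * φ x + g' x * φ x) := by
    refine integral_congr_ae ?_
    filter_upwards [Lp.coeFn_add g g'] with x hx
    rw [hx, Pi.add_apply, add_mul]
  rw [e1, e2, integral_add (integrable_lp_mul_of_hasCompactSupport f hD hDc)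
    (integrable_lp_mul_of_hasCompactSupport f' hD hDc),
    integral_add (integrable_lp_mul_of_hasCompactSupport g hφ.continuous hc)
    (integrable_lp_mul_of_hasCompactSupport g' hφ.continuous hc), h φ hφ hc hs, h' φ hφ hc hs]
  ring

lemma IsWeakPartial.smul {i : Fin d} {f g : L2 Ω} (h : IsWeakPartial Ω i f g) (c : ℝ) :
    IsWeakPartial Ω i (c • f) (c • g) := by
  intro φ hφ hc hs
  have e1 : ∫ x in Ω, (c • f) x * fderiv ℝ φ x (EuclideanSpace.single i 1)
      = ∫ x in Ω, c * (f x * fderiv ℝ φ x (EuclideanSpace.single i 1)) := by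
    refine integral_congr_ae ?_
    filter_upwards [Lp.coeFn_smul c f] with x hx
    rw [hx, Pi.smul_apply, smul_eq_mul, mul_assoc]
  have e2 : ∫ x in Ω, (c • g) x * φ x = ∫ x in Ω, c * (g x * φ x) := by
    refine integral_congr_ae ?_
    filter_upwards [Lp.coeFn_smul c g] with x hx
    rw [hx, Pi.smul_apply, smul_eq_mul, mul_assoc]
  rw [e1, e2, integral_const_mul, integral_const_mul, h φ hφ hc hs]
  ring

/-- An `L²` function with vanishing values has vanishing weak partial derivatives. -/
lemma IsWeakPartial.eq_zero (hΩ : IsOpen Ω) {i : Fin d} {g : L2 Ω}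
    (h : IsWeakPartial Ω i 0 g) : g = 0 := by
  have hloc : LocallyIntegrableOn g Ω :=
    locallyIntegrableOn_of_locallyIntegrable_restrict ((Lp.memLp g).locallyIntegrable (by norm_num))
  -- Fundamental lemma of the calculus of variations: `g` annihilates all test functions supported
  -- in Ω.
  have key := hΩ.ae_eq_zero_of_integral_contDiff_smul_eq_zero hloc ?_
  · rw [Lp.eq_zero_iff_ae_eq_zero]
    exact (ae_restrict_iff' hΩ.measurableSet).2 key
  · intro φ hφ hc hs
    have h1 := h φ hφ hc hs
    have e0 : ∫ x in Ω, (0 : L2 Ω) x * fderiv ℝ φ x (EuclideanSpace.single i 1) = 0 := by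
      refine integral_eq_zero_of_ae ?_
      filter_upwards [Lp.coeFn_zero ℝ 2 (volume.restrict Ω)] with x hx
      rw [hx, Pi.zero_apply, zero_mul]
    rw [e0, zero_eq_neg] at h1
    rw [← h1, ← setIntegral_eq_integral_of_forall_compl_eq_zero (s := Ω)]
    · exact integral_congr_ae (Eventually.of_forall fun x => by simp [mul_comm])
    · intro x hx
      rw [image_eq_zero_of_notMem_tsupport fun h => hx (hs h), zero_smul]

/-! ### Linearity of traces through their approximating sequences -/

lemma tendsto_eLpNorm_add {α : Type*} [MeasurableSpace α] {ν : Measure α} {f g : ℕ → α → ℝ}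
    {F G S : α → ℝ} (hf : ∀ n, AEStronglyMeasurable (f n) ν) (hg : ∀ n, AEStronglyMeasurable (g n) ν)
    (hF : AEStronglyMeasurable F ν) (hG : AEStronglyMeasurable G ν) (hS : S =ᵐ[ν] F + G)
    (h : Tendsto (fun n => eLpNorm (fun x => f n x - F x) 2 ν) atTop (𝓝 0))
    (h' : Tendsto (fun n => eLpNorm (fun x => g n x - G x) 2 ν) atTop (𝓝 0)) :
    Tendsto (fun n => eLpNorm (fun x => f n x + g n x - S x) 2 ν) atTop (𝓝 0) := by
  have h0 := h.add h'
  rw [add_zero] at h0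
  refine tendsto_of_tendsto_of_tendsto_of_le_of_le tendsto_const_nhds h0
    (fun n => zero_le) (fun n => ?_)
  refine le_trans (le_of_eq ?_)
    (eLpNorm_add_le ((hf n).sub hF) ((hg n).sub hG) one_le_two)
  refine eLpNorm_congr_ae ?_
  filter_upwards [hS] with x hx
  simp only [hx, Pi.add_apply]
  ring

lemma tendsto_eLpNorm_const_mul {α : Type*} [MeasurableSpace α] {ν : Measure α} {f : ℕ → α → ℝ}
    {F S : α → ℝ} (c : ℝ) (hS : S =ᵐ[ν] c • F)
    (h : Tendsto (fun n => eLpNorm (fun x => f n x - F x) 2 ν) atTop (𝓝 0)) :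
    Tendsto (fun n => eLpNorm (fun x => c * f n x - S x) 2 ν) atTop (𝓝 0) := by
  have h0 := ENNReal.Tendsto.const_mul (a := ‖c‖ₑ) h (Or.inr enorm_ne_top)
  rw [mul_zero] at h0
  refine h0.congr fun n => ?_
  rw [← eLpNorm_const_smul]
  refine eLpNorm_congr_ae ?_
  filter_upwards [hS] with x hx
  simp only [hx, Pi.smul_apply, smul_eq_mul]
  ring

lemma IsTrace.add {v w : Jet Ω} {τ τ' : L2Bdry Ω} (h : IsTrace Ω v τ) (h' : IsTrace Ω w τ') :
    IsTrace Ω (v + w) (τ + τ') := by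
  obtain ⟨φ, hφ, h1, h2, h3⟩ := h
  obtain ⟨ψ, hψ, k1, k2, k3⟩ := h'
  have m (n) (ν : Measure (Space d)) : AEStronglyMeasurable (φ n) ν :=
    (hφ n).continuous.aestronglyMeasurable
  have m' (n) (ν : Measure (Space d)) : AEStronglyMeasurable (ψ n) ν :=
    (hψ n).continuous.aestronglyMeasurable
  refine ⟨fun n x => φ n x + ψ n x, fun n => (hφ n).add (hψ n), ?_, fun i => ?_, ?_⟩
  · exact tendsto_eLpNorm_add (fun n => m n _) (fun n => m' n _) (Lp.aestronglyMeasurable _)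
      (Lp.aestronglyMeasurable _) (Lp.coeFn_add _ _) h1 k1
  · have e : ∀ n x, fderiv ℝ (fun x => φ n x + ψ n x) x (EuclideanSpace.single i 1)
        = fderiv ℝ (φ n) x (EuclideanSpace.single i 1)
          + fderiv ℝ (ψ n) x (EuclideanSpace.single i 1) := by
      intro n x
      rw [fderiv_fun_add ((hφ n).differentiable (by simp) x) ((hψ n).differentiable (by simp) x)]
      rfl
    simp_rw [e]
    exact tendsto_eLpNorm_add
      (fun n => (continuous_fderiv_apply (hφ n) _).aestronglyMeasurable)
      (fun n => (continuous_fderiv_apply (hψ n) _).aestronglyMeasurable)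
      (Lp.aestronglyMeasurable _) (Lp.aestronglyMeasurable _) (Lp.coeFn_add _ _) (h2 i) (k2 i)
  · exact tendsto_eLpNorm_add (fun n => m n _) (fun n => m' n _) (Lp.aestronglyMeasurable _)
      (Lp.aestronglyMeasurable _) (Lp.coeFn_add _ _) h3 k3

lemma IsTrace.smul {v : Jet Ω} {τ : L2Bdry Ω} (h : IsTrace Ω v τ) (c : ℝ) :
    IsTrace Ω (c • v) (c • τ) := by
  obtain ⟨φ, hφ, h1, h2, h3⟩ := h
  refine ⟨fun n x => c * φ n x, fun n => contDiff_const.mul (hφ n), ?_, fun i => ?_, ?_⟩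
  · exact tendsto_eLpNorm_const_mul c (Lp.coeFn_smul _ _) h1
  · have e : ∀ n x, fderiv ℝ (fun x => c * φ n x) x (EuclideanSpace.single i 1)
        = c * fderiv ℝ (φ n) x (EuclideanSpace.single i 1) := by
      intro n x
      rw [fderiv_const_mul ((hφ n).differentiable (by simp) x)]
      rfl
    simp_rw [e]
    exact tendsto_eLpNorm_const_mul c (Lp.coeFn_smul _ _) (h2 i)
  · exact tendsto_eLpNorm_const_mul c (Lp.coeFn_smul _ _) h3

lemma isTrace_zero : IsTrace Ω 0 0 := by
  have h (ν : Measure (Space d)) : eLpNorm (fun x => 0 - (0 : Lp ℝ 2 ν) x) 2 ν = 0 := by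
    rw [← eLpNorm_zero (p := 2) (μ := ν) (ε := ℝ)]
    refine eLpNorm_congr_ae ?_
    filter_upwards [Lp.coeFn_zero ℝ 2 ν] with x hx
    rw [hx, Pi.zero_apply, sub_zero]
  refine ⟨fun _ _ => 0, fun _ => contDiff_const, ?_, fun i => ?_, ?_⟩
  · exact tendsto_const_nhds.congr fun _ => (h _).symm
  · simp only [fderiv_fun_const, Pi.zero_apply, zero_apply]
    exact tendsto_const_nhds.congr fun _ => (h _).symm
  · exact tendsto_const_nhds.congr fun _ => (h _).symm

/-- The Sobolev space `H¹_{0,D}(Ω)` as a subspace. -/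
def h1DSubmodule (Ω ΓD : Set (Space d)) : Submodule ℝ (Jet Ω) where
  carrier := H1D Ω ΓD
  zero_mem' := by
    refine ⟨fun i => ?_, 0, isTrace_zero, ae_restrict_of_ae ?_⟩
    · intro φ hφ hc hs
      have e0 : ∀ ψ : Space d → ℝ, ∫ x in Ω, (0 : L2 Ω) x * ψ x = 0 := by
        intro ψ
        refine integral_eq_zero_of_ae ?_
        filter_upwards [Lp.coeFn_zero ℝ 2 (volume.restrict Ω)] with x hx
        rw [hx, Pi.zero_apply, zero_mul]
      exact (e0 _).trans (neg_eq_zero.2 (e0 _)).symm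
    · filter_upwards [Lp.coeFn_zero ℝ 2 (surf Ω)] with x hx
      simpa using hx
  add_mem' := by
    rintro v w ⟨hv, τ, hτ, hτ0⟩ ⟨hw, τ', hτ', hτ0'⟩
    refine ⟨fun i => (hv i).add (hw i), τ + τ', hτ.add hτ', ?_⟩
    filter_upwards [hτ0, hτ0', ae_restrict_of_ae (Lp.coeFn_add τ τ')] with x h1 h2 h3
    rw [h3, Pi.add_apply, h1, h2, add_zero]
  smul_mem' := by
    rintro c v ⟨hv, τ, hτ, hτ0⟩
    refine ⟨fun i => (hv i).smul c, c • τ, hτ.smul c, ?_⟩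
    filter_upwards [hτ0, ae_restrict_of_ae (Lp.coeFn_smul c τ)] with x h1 h3
    rw [h3, Pi.smul_apply, h1, smul_zero]

/-- The space `Z_h` as a subspace. -/
def zhSubmodule (Ω : Set (Space d)) (K : Geometry.SimplicialComplex ℝ (Space d)) (l : ℕ) :
    Submodule ℝ (L2 Ω) where
  carrier := Zh Ω K l
  zero_mem' := by
    intro s _ _
    refine ⟨0, by simp, ?_⟩
    filter_upwards [ae_mono (Measure.restrict_mono inter_subset_left le_rfl)
      (Lp.coeFn_zero ℝ 2 (volume.restrict Ω))] with x hx
    simpa using hx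
  add_mem' := by
    intro v w hv hw s hs hc
    obtain ⟨P, hP, h1⟩ := hv s hs hc
    obtain ⟨Q, hQ, h2⟩ := hw s hs hc
    refine ⟨P + Q, (MvPolynomial.totalDegree_add P Q).trans (max_le hP hQ), ?_⟩
    filter_upwards [h1, h2, ae_mono (Measure.restrict_mono inter_subset_left le_rfl)
      (Lp.coeFn_add v w)] with x h1 h2 h3
    rw [h3, Pi.add_apply, h1, h2, map_add]
  smul_mem' := by
    intro c v hv s hs hc
    obtain ⟨P, hP, h1⟩ := hv s hs hc
    refine ⟨c • P, (MvPolynomial.totalDegree_smul_le c P).trans hP, ?_⟩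
    filter_upwards [h1, ae_mono (Measure.restrict_mono inter_subset_left le_rfl)
      (Lp.coeFn_smul c v)] with x h1 h3
    rw [h3, Pi.smul_apply, h1, MvPolynomial.smul_eval, smul_eq_mul]

/-- The space of continuous finite elements as a subspace. -/
def contFESubmodule (Ω ΓD : Set (Space d)) (K : Geometry.SimplicialComplex ℝ (Space d)) (k : ℕ) :
    Submodule ℝ (Jet Ω) where
  carrier := contFE Ω ΓD K k
  zero_mem' := by
    refine ⟨(h1DSubmodule Ω ΓD).zero_mem, ⟨0, continuousOn_const, ?_⟩, (zhSubmodule Ω K k).zero_mem⟩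
    exact Lp.coeFn_zero ℝ 2 (volume.restrict Ω)
  add_mem' := by
    rintro v w ⟨hv, ⟨f, hf, hvf⟩, hvp⟩ ⟨hw, ⟨g, hg, hwg⟩, hwp⟩
    refine ⟨(h1DSubmodule Ω ΓD).add_mem hv hw, ⟨f + g, hf.add hg, ?_⟩,
      (zhSubmodule Ω K k).add_mem hvp hwp⟩
    filter_upwards [Lp.coeFn_add v.1 w.1, hvf, hwg] with x h1 h2 h3
    rw [Prod.fst_add, h1, Pi.add_apply, Pi.add_apply, h2, h3]
  smul_mem' := by
    rintro c v ⟨hv, ⟨f, hf, hvf⟩, hvp⟩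
    refine ⟨(h1DSubmodule Ω ΓD).smul_mem c hv, ⟨c • f, hf.const_smul c, ?_⟩,
      (zhSubmodule Ω K k).smul_mem c hvp⟩
    filter_upwards [Lp.coeFn_smul c v.1, hvf] with x h1 h2
    rw [Prod.smul_fst, h1, Pi.smul_apply, Pi.smul_apply, h2]

/-- The space `U_h` as a subspace. -/
def uhSubmodule (Ω ΓD : Set (Space d)) (K : Geometry.SimplicialComplex ℝ (Space d)) (k : ℕ) :
    Submodule ℝ (VJet Ω) where
  carrier := Uh Ω ΓD K k
  zero_mem' _ := (contFESubmodule Ω ΓD K k).zero_mem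
  add_mem' hv hw i := (contFESubmodule Ω ΓD K k).add_mem (hv i) (hw i)
  smul_mem' c _ hv i := (contFESubmodule Ω ΓD K k).smul_mem c (hv i)

/-! ### Finite dimension -/

lemma measurableSet_convexHull_finset (s : Finset (Space d)) :
    MeasurableSet (convexHull ℝ (s : Set (Space d))) :=
  (s.finite_toSet.isCompact_convexHull ℝ).measurableSet

/-- At most `d` points span a proper affine subspace, which is Lebesgue null. -/
lemma volume_convexHull_eq_zero {s : Finset (Space d)} (hs : s.card ≤ d) :
    volume (convexHull ℝ (s : Set (Space d))) = 0 := by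
  refine measure_mono_null (convexHull_subset_affineSpan _)
    (Measure.addHaar_affineSubspace volume _ fun htop => ?_)
  rcases s.eq_empty_or_nonempty with rfl | hne
  · simp at htop
  obtain ⟨n, hn⟩ : ∃ n, s.card = n + 1 := ⟨s.card - 1, by have := hne.card_pos; omega⟩
  have h1 := finrank_vectorSpan_range_le ℝ (fun x : s => (x : Space d)) (n := n) (by simpa using hn)
  have h2 : vectorSpan ℝ (Set.range fun x : s => (x : Space d)) = ⊤ := by
    rw [← direction_affineSpan]
    simp [htop]
  rw [h2, finrank_top, finrank_euclideanSpace, Fintype.card_fin] at h1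
  omega

/-- The simplices of full dimension of a triangulation cover the domain up to a null set. -/
lemma IsTriangulation.ae_exists_mem (hK : IsTriangulation Ω K) (hΩ : MeasurableSet Ω) :
    ∀ᵐ x ∂volume.restrict Ω, ∃ s ∈ K.faces, s.card = d + 1 ∧
      x ∈ convexHull ℝ (s : Set (Space d)) := by
  have h : ∀ᵐ x : Space d, ∀ s ∈ K.faces, s.card ≤ d → x ∉ convexHull ℝ (s : Set (Space d)) := by
    refine (ae_ball_iff hK.finite.countable).2 fun s _ => ?_
    by_cases hs : s.card ≤ d
    · filter_upwards [measure_eq_zero_iff_ae_notMem.1 (volume_convexHull_eq_zero hs)] with x hx _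
      exact hx
    · exact Eventually.of_forall fun x h => absurd h hs
  rw [ae_restrict_iff' hΩ]
  filter_upwards [h] with x hx hxΩ
  have hx1 : x ∈ K.space := hK.space_eq ▸ subset_closure hxΩ
  obtain ⟨s, hs, hxs⟩ := Geometry.SimplicialComplex.mem_space_iff.1 hx1
  -- Affine independence allows at most `d + 1` vertices; fewer would put `x` in the discarded null
  -- set.
  refine ⟨s, hs, le_antisymm ?_ ?_, hxs⟩
  · have := (K.indep hs).card_le_finrank_succ
    simp only [Fintype.card_coe] at this
    refine this.trans (Nat.succ_le_succ ?_)
    exact (Submodule.finrank_le _).trans (by simp)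
  · by_contra hlt
    exact hx s hs (by omega) hxs

/-- `R` relates a family of polynomials, one per face, to the functions it represents. The
polynomials determine the function a.e. because full-dimensional simplices cover Ω up to a null set,
so `R` embeds in a finite-dimensional space, and `Z_h` lies in its image. -/
lemma finiteDimensional_zhSubmodule (hK : IsTriangulation Ω K) (hΩ : MeasurableSet Ω) (l : ℕ) :
    FiniteDimensional ℝ (zhSubmodule Ω K l) := by
  have : Finite K.faces := hK.finite
  let R : Submodule ℝ ((K.faces → MvPolynomial.restrictTotalDegree (Fin d) ℝ l) × L2 Ω) :=
    { carrier := {r | ∀ s : K.faces, s.1.card = d + 1 →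
        ∀ᵐ x ∂volume.restrict (Ω ∩ convexHull ℝ (s.1 : Set (Space d))),
          r.2 x = MvPolynomial.eval (fun i => x i) (r.1 s).1}
      zero_mem' := by
        intro s _
        filter_upwards [ae_mono (Measure.restrict_mono inter_subset_left le_rfl)
          (Lp.coeFn_zero ℝ 2 (volume.restrict Ω))] with x hx
        simpa using hx
      add_mem' := by
        intro r r' h h' s hs
        filter_upwards [h s hs, h' s hs, ae_mono (Measure.restrict_mono inter_subset_left le_rfl)
          (Lp.coeFn_add r.2 r'.2)] with x h1 h2 h3
        rw [Prod.snd_add, h3, Pi.add_apply, h1, h2, Prod.fst_add, Pi.add_apply, Submodule.coe_add,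
          map_add]
      smul_mem' := by
        intro c r h s hs
        filter_upwards [h s hs, ae_mono (Measure.restrict_mono inter_subset_left le_rfl)
          (Lp.coeFn_smul c r.2)] with x h1 h3
        rw [Prod.smul_snd, h3, Pi.smul_apply, h1, Prod.smul_fst, Pi.smul_apply, Submodule.coe_smul,
          MvPolynomial.smul_eval, smul_eq_mul] }
  have hinj : Function.Injective (LinearMap.fst ℝ _ (L2 Ω) ∘ₗ R.subtype) := by
    refine (injective_iff_map_eq_zero _).2 ?_
    rintro ⟨⟨P, v⟩, h⟩ (rfl : P = 0)
    have hv : v = 0 := by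
      rw [Lp.eq_zero_iff_ae_eq_zero]
      have h1 : ∀ᵐ x : Space d, ∀ s : K.faces, s.1.card = d + 1 →
          x ∈ Ω ∩ convexHull ℝ (s.1 : Set (Space d)) → v x = 0 := by
        refine ae_all_iff.2 fun s => ?_
        by_cases hs : s.1.card = d + 1
        · have h2 := h s hs
          rw [ae_restrict_iff' (hΩ.inter (measurableSet_convexHull_finset _))] at h2
          filter_upwards [h2] with x hx _ hxm
          simpa using hx hxm
        · exact Eventually.of_forall fun x h => absurd h hs
      filter_upwards [hK.ae_exists_mem hΩ, ae_restrict_of_ae h1, ae_restrict_mem hΩ] with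
        x ⟨s, hs, hc, hx⟩ h2 hxΩ
      exact h2 ⟨s, hs⟩ hc ⟨hxΩ, hx⟩
    subst hv
    rfl
  have hR : FiniteDimensional ℝ R := FiniteDimensional.of_injective _ hinj
  refine Submodule.finiteDimensional_of_le
    (S₂ := LinearMap.range (LinearMap.snd ℝ _ (L2 Ω) ∘ₗ R.subtype)) ?_
  intro v hv
  choose! P hP hPv using hv
  -- Lower-dimensional faces carry no condition; the value 0 there keeps the degree bound.
  refine ⟨⟨(fun s => ⟨if s.1.card = d + 1 then P s.1 else 0, ?_⟩, v), ?_⟩, rfl⟩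
  · rw [MvPolynomial.mem_restrictTotalDegree]
    split_ifs with hs
    · exact hP s.1 s.2 hs
    · simp
  · intro s hs
    simp only [hs, if_true]
    exact hPv s.1 s.2 hs

lemma H1.eq_zero_of_fst_eq_zero (hΩ : IsOpen Ω) {v : Jet Ω} (hv : v ∈ H1 Ω) (h : v.1 = 0) :
    v = 0 := by
  refine Prod.ext h (funext fun i => IsWeakPartial.eq_zero hΩ (i := i) ?_)
  have := hv i
  rwa [h] at this

/-- The weak gradient is determined by the function, so forgetting it embeds this space in a space
of piecewise polynomials. -/
lemma finiteDimensional_contFESubmodule (hK : IsTriangulation Ω K) (hΩ : IsOpen Ω) (k : ℕ) :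
    FiniteDimensional ℝ (contFESubmodule Ω ΓD K k) := by
  have := finiteDimensional_zhSubmodule hK hΩ.measurableSet k
  let φ : contFESubmodule Ω ΓD K k →ₗ[ℝ] zhSubmodule Ω K k :=
    (LinearMap.fst ℝ (L2 Ω) (Fin d → L2 Ω) ∘ₗ (contFESubmodule Ω ΓD K k).subtype).codRestrict _
      fun v => v.2.2.2
  refine FiniteDimensional.of_injective φ ?_
  rw [← LinearMap.ker_eq_bot, LinearMap.ker_eq_bot']
  intro v hv
  exact Subtype.ext (H1.eq_zero_of_fst_eq_zero hΩ v.2.1.1 (congrArg Subtype.val hv))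

lemma finiteDimensional_uhSubmodule (hK : IsTriangulation Ω K) (hΩ : IsOpen Ω) (k : ℕ) :
    FiniteDimensional ℝ (uhSubmodule Ω ΓD K k) := by
  have := finiteDimensional_contFESubmodule (ΓD := ΓD) hK hΩ k
  let φ : (Fin d → contFESubmodule Ω ΓD K k) →ₗ[ℝ] VJet Ω :=
    LinearMap.pi fun i => (contFESubmodule Ω ΓD K k).subtype ∘ₗ LinearMap.proj i
  refine Submodule.finiteDimensional_of_le (S₂ := LinearMap.range φ) ?_
  intro v hv
  exact ⟨fun i => ⟨v i, hv i⟩, rfl⟩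

end FunctionSpaces

variable {d : ℕ} {Ω ΓD ΓN : Set (Space d)}

/-! ### Strain, gradient and trace as maps of Hilbert spaces -/

/-- The strain as a linear map into the Hilbert space of matrix fields. -/
def strainMap (Ω : Set (Space d)) : VJet Ω →ₗ[ℝ] PiLp 2 fun _ : Fin d × Fin d => L2 Ω where
  toFun v := WithLp.toLp 2 fun ij => strain v ij.1 ij.2
  map_add' v w := by
    ext1 ij
    simp only [PiLp.add_apply, strain, Pi.add_apply, Prod.snd_add, ← smul_add]
    congr 1
    abel
  map_smul' c v := by
    ext1 ij
    simp only [PiLp.smul_apply, strain, Pi.smul_apply, Prod.smul_snd, ← smul_add, RingHom.id_apply]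
    exact smul_comm _ _ _

/-- The gradient as a continuous linear map into the Hilbert space of vector fields. -/
def gradMap (Ω : Set (Space d)) : Jet Ω →L[ℝ] PiLp 2 fun _ : Fin d => L2 Ω :=
  (PiLp.continuousLinearEquiv 2 ℝ fun _ : Fin d => L2 Ω).symm.toContinuousLinearMap ∘L
    ContinuousLinearMap.snd ℝ (L2 Ω) (Fin d → L2 Ω)

/-- The trace of a matrix field. -/
def matrixTrace (Ω : Set (Space d)) : (PiLp 2 fun _ : Fin d × Fin d => L2 Ω) →L[ℝ] L2 Ω :=
  ∑ i : Fin d, PiLp.proj 2 (fun _ : Fin d × Fin d => L2 Ω) (i, i)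

lemma inner_strainMap (v w : VJet Ω) :
    inner ℝ (strainMap Ω v) (strainMap Ω w) = strainInner v w := by
  rw [PiLp.inner_apply, Fintype.sum_prod_type]
  rfl

lemma norm_sq_strainMap (v : VJet Ω) : ‖strainMap Ω v‖ ^ 2 = strainNormSq v := by
  rw [PiLp.norm_sq_eq_of_L2, Fintype.sum_prod_type]
  rfl

lemma inner_gradMap (v w : Jet Ω) : inner ℝ (gradMap Ω v) (gradMap Ω w) = gradInner v w := by
  rw [PiLp.inner_apply]
  rfl

lemma norm_sq_gradMap (v : Jet Ω) : ‖gradMap Ω v‖ ^ 2 = gradNormSq v := by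
  rw [PiLp.norm_sq_eq_of_L2]
  rfl

/-- Symmetrisation keeps the diagonal, so the divergence factors through the strain and
`energy_estimate` can take the strain as its unknown. -/
lemma matrixTrace_strainMap (v : VJet Ω) : matrixTrace Ω (strainMap Ω v) = dvg v := by
  simp only [matrixTrace, sum_apply, dvg]
  refine Finset.sum_congr rfl fun i _ => ?_
  change (2⁻¹ : ℝ) • ((v i).2 i + (v i).2 i) = _
  rw [← two_smul ℝ, smul_smul]
  norm_num

lemma dvg_sub (v w : VJet Ω) : dvg (v - w) = dvg v - dvg w := by
  simp only [← matrixTrace_strainMap, map_sub]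

lemma strainInner_sub_left (u v w : VJet Ω) :
    strainInner (u - v) w = strainInner u w - strainInner v w := by
  simp only [← inner_strainMap, map_sub, inner_sub_left]

lemma gradInner_sub_left (u v w : Jet Ω) :
    gradInner (u - v) w = gradInner u w - gradInner v w := by
  simp only [← inner_gradMap, map_sub, inner_sub_left]

lemma strainNormSq_add_le (v w : VJet Ω) :
    strainNormSq (v + w) ≤ 2 * strainNormSq v + 2 * strainNormSq w := by
  simp only [← norm_sq_strainMap, map_add]
  nlinarith [norm_add_le (strainMap Ω v) (strainMap Ω w),
    norm_nonneg (strainMap Ω v + strainMap Ω w), sq_nonneg (‖strainMap Ω v‖ - ‖strainMap Ω w‖)]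

lemma gradNormSq_add_le (v w : Jet Ω) :
    gradNormSq (v + w) ≤ 2 * gradNormSq v + 2 * gradNormSq w := by
  simp only [← norm_sq_gradMap, map_add]
  nlinarith [norm_add_le (gradMap Ω v) (gradMap Ω w),
    norm_nonneg (gradMap Ω v + gradMap Ω w), sq_nonneg (‖gradMap Ω v‖ - ‖gradMap Ω w‖)]

lemma norm_strainMap_le_seminorm1 (v : VJet Ω) : ‖strainMap Ω v‖ ≤ seminorm1 v := by
  refine Real.le_sqrt_of_sq_le ?_
  rw [norm_sq_strainMap]
  have h : ∀ i j, ‖strain v i j‖ ^ 2 ≤ 2⁻¹ * ‖(v i).2 j‖ ^ 2 + 2⁻¹ * ‖(v j).2 i‖ ^ 2 := by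
    intro i j
    rw [strain, norm_smul]
    norm_num
    nlinarith [norm_add_le ((v i).2 j) ((v j).2 i), norm_nonneg ((v i).2 j + (v j).2 i),
      sq_nonneg (‖(v i).2 j‖ - ‖(v j).2 i‖)]
  calc strainNormSq v
      ≤ ∑ i, ∑ j, (2⁻¹ * ‖(v i).2 j‖ ^ 2 + 2⁻¹ * ‖(v j).2 i‖ ^ 2) :=
        Finset.sum_le_sum fun i _ => Finset.sum_le_sum fun j _ => h i j
    _ = ∑ i, ∑ j, ‖(v i).2 j‖ ^ 2 := by
        simp only [Finset.sum_add_distrib, ← Finset.mul_sum]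
        rw [Finset.sum_comm (f := fun i j => ‖(v j).2 i‖ ^ 2)]
        ring

/-- The inf-sup condition bounds a total stress by the strain that balances it. -/
lemma InfSup.norm_le {b μ : ℝ} (hμ : 0 ≤ μ) {U : Set (VJet Ω)} {Z : Set (L2 Ω)}
    (h : InfSup b U Z) {w : L2 Ω} (hw : w ∈ Z) {u : VJet Ω}
    (hu : ∀ v ∈ U, 2 * μ * strainInner u v = inner ℝ w (dvg v)) :
    b * ‖w‖ ≤ 2 * μ * ‖strainMap Ω u‖ := by
  -- Nonnegativity of the bound covers an empty set of quotients, and below it covers a vanishing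
  -- seminorm, where the quotient is 0.
  refine (h w hw).trans (Real.sSup_le ?_ (by positivity))
  rintro r ⟨v, hv, -, rfl⟩
  refine div_le_of_le_mul₀ (Real.sqrt_nonneg _) (by positivity) ?_
  rw [← hu v hv, ← inner_strainMap, mul_assoc (2 * μ)]
  gcongr
  exact (real_inner_le_norm _ _).trans (by gcongr; exact norm_strainMap_le_seminorm1 v)

/-! ### The semi-discrete error estimate -/

lemma norm_sq_sub_le_of_norm_sub_le {E : Type*} [NormedAddCommGroup E] (a m c : E) :
    ‖a - c‖ ^ 2 ≤ 2 * ‖a - m‖ ^ 2 + 2 * ‖m - c‖ ^ 2 := by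
  have := norm_sub_le_norm_sub_add_norm_sub a m c
  nlinarith [norm_nonneg (a - c), sq_nonneg (‖a - m‖ - ‖m - c‖)]

/-- The distance of the semi-discrete solution to the projections of the exact solution is controlled
by the time derivatives of the projection errors. -/
theorem discrete_error_estimate (hΩ : IsOpen Ω) {K : Geometry.SimplicialComplex ℝ (Space d)}
    (hK : IsTriangulation Ω K) {μ lam κ T b : ℝ} (hμ : 0 < μ) (hlam : 0 < lam) (hκ : 0 < κ)
    (hb : 0 < b) {k l : ℕ} (hinf : InfSup b (Uh Ω ΓD K k) (Zh Ω K l)) {D : ProblemData Ω ΓN}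
    {u : ℝ → VJet Ω} {q qt : ℝ → L2 Ω} {p : ℝ → Jet Ω} {pt : ℝ → L2 Ω}
    (hsol : IsWeakSolution ΓD μ lam κ T D u q qt p pt)
    {Qu : ℝ → VJet Ω} {Qq : ℝ → L2 Ω} {Qp : ℝ → Jet Ω}
    (hS : ∀ t ∈ Icc 0 T,
      IsStokesProjection μ (Uh Ω ΓD K k) (Zh Ω K l) (u t) (q t) (Qu t) (Qq t))
    (hE : ∀ t ∈ Icc 0 T, IsEllipticProjection (Ph Ω ΓD K k) (p t) (Qp t))
    {ηqt ηpt : ℝ → L2 Ω} (hηq : HasTimeDeriv T (fun t => q t - Qq t) ηqt)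
    (hηp : HasTimeDeriv T (fun t => (p t).1 - (Qp t).1) ηpt)
    {uh : ℝ → VJet Ω} {qh qht : ℝ → L2 Ω} {ph : ℝ → Jet Ω} {pht : ℝ → L2 Ω}
    (hdis : IsSemidiscreteSolution μ lam κ T D (Uh Ω ΓD K k) (Zh Ω K l) (Ph Ω ΓD K k)
      (Qu 0) (Qq 0) (Qp 0) uh qh qht ph pht) {t : ℝ} (ht : t ∈ Ioc 0 T) :
    κ * gradNormSq (Qp t - ph t) ≤ lam⁻¹ / 2 * (∫ s in (0 : ℝ)..t, ‖ηqt s - ηpt s‖ ^ 2) ∧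
    μ * strainNormSq (Qu t - uh t)
      ≤ T * lam⁻¹ / 8 * (∫ s in (0 : ℝ)..t, ‖ηqt s - ηpt s‖ ^ 2) ∧
    ‖Qq t - qh t‖ ^ 2
      ≤ 4 * μ / b ^ 2 * (T * lam⁻¹ / 8 * ∫ s in (0 : ℝ)..t, ‖ηqt s - ηpt s‖ ^ 2) := by
  have hz : (0 : ℝ) ∈ Icc 0 T := ⟨le_rfl, ht.1.le.trans ht.2⟩
  have hUfin : FiniteDimensional ℝ (uhSubmodule Ω ΓD K k) := finiteDimensional_uhSubmodule hK hΩ k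
  have hZfin : FiniteDimensional ℝ (zhSubmodule Ω K l) :=
    finiteDimensional_zhSubmodule hK hΩ.measurableSet l
  have hPfin : FiniteDimensional ℝ (contFESubmodule Ω ΓD K (k - 1)) :=
    finiteDimensional_contFESubmodule hK hΩ (k - 1)
  have hmom : ∀ s ∈ Icc 0 T, ∀ v ∈ Uh Ω ΓD K k,
      2 * μ * strainInner (Qu s - uh s) v = inner ℝ (Qq s - qh s) (dvg v) := by
    intro s hs v hv
    -- The exact momentum equation is given only for positive times; at 0 both discrete errors
    -- vanish.
    rcases hs.1.eq_or_lt with rfl | hs0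
    · rw [hdis.init_u, hdis.init_q, sub_self, sub_self, inner_zero_left, ← inner_strainMap,
        map_zero, inner_zero_left, mul_zero]
    choose τ hτ _ using fun i => (hv i).1.2
    have h1 := hsol.momentum s ⟨hs0, hs.2⟩ v (fun i => (hv i).1) τ hτ
    have h2 := hdis.momentum s hs v hv τ hτ
    have h3 := (hS s hs).momentum v hv
    rw [strainInner_sub_left, inner_sub_left]
    linear_combination h3 + h1 - h2
  have hcoup0 : ∀ s ∈ Icc 0 T, ∀ w : L2 Ω,
      lam⁻¹ * inner ℝ (q s - (p s).1) w + inner ℝ (dvg (u s)) w = 0 := by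
    intro s hs w
    -- At time 0 the coupling is the prescribed value of `q 0`.
    rcases hs.1.eq_or_lt with rfl | hs0
    · rw [hsol.init_q, hsol.init_p, hsol.init_u, add_sub_cancel_right, inner_neg_left,
        real_inner_smul_left]
      field_simp
      ring
    · exact hsol.coupling s ⟨hs0, hs.2⟩ w
  -- The projection is differentiated as exact solution minus projection error.
  have hqt : HasTimeDeriv T (fun s => Qq s - qh s) (fun s => qt s - ηqt s - qht s) :=
    ((hsol.deriv_q.sub hηq).sub hdis.deriv_q).congr fun s _ => by abel
  have hpt : HasTimeDeriv T (fun s => ContinuousLinearMap.fst ℝ (L2 Ω) (Fin d → L2 Ω)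
      (Qp s - ph s)) (fun s => pt s - ηpt s - pht s) :=
    ((hsol.deriv_p.sub hηp).sub hdis.deriv_p).congr fun s _ => by
      simp only [ContinuousLinearMap.coe_fst', Prod.fst_sub]
      abel
  have hρ := hηq.sub hηp
  have key := energy_estimate (κ := κ) hμ hlam (zhSubmodule Ω K l)
    ((uhSubmodule Ω ΓD K k).map (strainMap Ω)) (contFESubmodule Ω ΓD K (k - 1))
    (matrixTrace Ω) (ContinuousLinearMap.fst ℝ (L2 Ω) (Fin d → L2 Ω)) (gradMap Ω)
    (fun v hv h => H1.eq_zero_of_fst_eq_zero hΩ hv.1.1 h)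
    (σ := fun s => strainMap Ω (Qu s - uh s)) (θp := fun s => Qp s - ph s)
    (fun s hs => ⟨_, (uhSubmodule Ω ΓD K k).sub_mem (hS s hs).mem_u (hdis.mem_u s hs), rfl⟩)
    (fun s hs => (zhSubmodule Ω K l).sub_mem (hS s hs).mem_q (hdis.mem_q s hs))
    (fun s hs => (contFESubmodule Ω ΓD K (k - 1)).sub_mem (hE s hs).mem (hdis.mem_p s hs))
    (by simp [hdis.init_q]) (by simp [hdis.init_p]) hqt hpt hρ.memLp
    (by
      rintro s hs _ ⟨v, hv, rfl⟩
      rw [inner_strainMap, matrixTrace_strainMap]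
      exact hmom s hs v hv)
    (by
      intro s hs w hw
      have h1 := hcoup0 s hs w
      have h2 := hcoup0 0 hz w
      have h3 := hdis.coupling s hs w hw
      have h4 := (hS s hs).divergence w hw
      have h5 := (hS 0 hz).divergence w hw
      -- The integral of ρ is the increment of `ηq - ηp` from 0 to `s`. Subtracting the equations at
      -- time 0 also removes the constant residual of the scheme.
      have h6 := eq_sub_of_add_eq' (hρ.eq_integral s hs).symm
      rw [hdis.init_u, hdis.init_p, hdis.init_q] at h3
      rw [real_inner_comm, real_inner_comm (dvg (u s))] at h4
      rw [real_inner_comm, real_inner_comm (dvg (u 0))] at h5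
      rw [h6, matrixTrace_strainMap, dvg_sub]
      simp only [ContinuousLinearMap.coe_fst', Prod.fst_sub, inner_add_left, inner_sub_left]
        at h1 h2 h3 ⊢
      linear_combination h1 - h2 - h3 + h4 - h5)
    (by
      filter_upwards [hsol.mass, hdis.mass, ae_restrict_mem measurableSet_Ioc] with s h1 h2 hs w hw
      obtain ⟨τ, hτ, -⟩ := hw.1.2
      have h3 := h1 w hw.1 τ hτ
      have h4 := h2 w hw τ hτ
      have h5 := (hE s (Ioc_subset_Icc_self hs)).eq w hw
      rw [inner_gradMap, gradInner_sub_left, h5]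
      simp only [ContinuousLinearMap.coe_fst', inner_add_left, inner_sub_left] at h3 h4 ⊢
      linear_combination h4 - h3) ht
  obtain ⟨h1, h2⟩ := key
  have h2 := h2 hκ.le
  rw [norm_sq_gradMap] at h1
  have h3 := hinf.norm_le hμ.le ((zhSubmodule Ω K l).sub_mem
    (hS t (Ioc_subset_Icc_self ht)).mem_q (hdis.mem_q t (Ioc_subset_Icc_self ht)))
    (hmom t (Ioc_subset_Icc_self ht))
  refine ⟨h1, by rwa [norm_sq_strainMap] at h2, ?_⟩
  refine le_trans ?_ (mul_le_mul_of_nonneg_left h2 (by positivity))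
  rw [div_mul_eq_mul_div, le_div_iff₀ (by positivity)]
  -- Squaring `b ‖θq‖ ≤ 2μ ‖σ‖` gives the factor `4μ / b²` in front of `μ ‖σ‖²`.
  have h4 := pow_le_pow_left₀ (by positivity) h3 2
  nlinarith [h4]

end Biot

end

theorem mainTheorem2 {d : ℕ} (hd : d = 2 ∨ d = 3)
    (Ω ΓD ΓN : Set (Space d)) (hΩ : IsPolyhedralDomain Ω) (hΓ : IsBoundarySplitting Ω ΓD ΓN)
    (μ lam κ T b : ℝ) (hμ : 0 < μ) (hlam : 0 < lam) (hκ : 0 < κ) (hT : 0 < T) (hb : 0 < b)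
    (k l : ℕ) (hk : 2 ≤ k) :
    -- the constant does not depend on the mesh, the data, the solutions or the time
    ∃ C : ℝ, 0 < C ∧
      ∀ K : Geometry.SimplicialComplex ℝ (Space d), IsTriangulation Ω K →
      InfSup b (Uh Ω ΓD K k) (Zh Ω K l) →
      ∀ (D : ProblemData Ω ΓN)
        -- the exact solution
        (u : ℝ → VJet Ω) (q qt : ℝ → L2 Ω) (p : ℝ → Jet Ω) (pt : ℝ → L2 Ω),
      IsWeakSolution ΓD μ lam κ T D u q qt p pt →
      ∀ -- the Stokes and elliptic projections of the exact solution
        (Qu : ℝ → VJet Ω) (Qq : ℝ → L2 Ω) (Qp : ℝ → Jet Ω),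
      (∀ t ∈ Icc 0 T, IsStokesProjection μ (Uh Ω ΓD K k) (Zh Ω K l) (u t) (q t) (Qu t) (Qq t)) →
      (∀ t ∈ Icc 0 T, IsEllipticProjection (Ph Ω ΓD K k) (p t) (Qp t)) →
      ∀ -- the time derivatives of the projection errors
        (ηqt ηpt : ℝ → L2 Ω),
      HasTimeDeriv T (fun t => q t - Qq t) ηqt →
      HasTimeDeriv T (fun t => (p t).1 - (Qp t).1) ηpt →
      ∀ -- the semi-discrete solution
        (uh : ℝ → VJet Ω) (qh qht : ℝ → L2 Ω) (ph : ℝ → Jet Ω) (pht : ℝ → L2 Ω),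
      IsSemidiscreteSolution μ lam κ T D (Uh Ω ΓD K k) (Zh Ω K l) (Ph Ω ΓD K k)
        (Qu 0) (Qq 0) (Qp 0) uh qh qht ph pht →
      ∀ t ∈ Ioc 0 T,
        μ * strainNormSq (u t - uh t) + ‖q t - qh t‖ ^ 2
            ≤ C * (μ * strainNormSq (u t - Qu t) + ‖q t - Qq t‖ ^ 2
                + ∫ s in (0 : ℝ)..t, ‖ηqt s - ηpt s‖ ^ 2) ∧
        κ * gradNormSq (p t - ph t)
            ≤ C * (κ * gradNormSq (p t - Qp t)
                + ∫ s in (0 : ℝ)..t, ‖ηqt s - ηpt s‖ ^ 2) := by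
  set c : ℝ := T * lam⁻¹ / 8 with hc
  have hc0 : 0 < c := by positivity
  -- The 2 comes from squaring the triangle inequality. The middle term is twice the strain and
  -- stress constants, and `lam⁻¹` is twice the pressure constant `lam⁻¹ / 2`.
  refine ⟨2 + 2 * (c + 4 * μ / b ^ 2 * c) + lam⁻¹, by positivity, ?_⟩
  intro K hK hinf D u q qt p pt hsol Qu Qq Qp hS hE ηqt ηpt hηq hηp uh qh qht ph pht hdis t ht
  obtain ⟨h1, h2, h3⟩ :=
    discrete_error_estimate hΩ.isOpen hK hμ hlam hκ hb hinf hsol hS hE hηq hηp hdis ht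
  rw [← hc] at h2 h3
  have hI : 0 ≤ ∫ s in (0 : ℝ)..t, ‖ηqt s - ηpt s‖ ^ 2 :=
    intervalIntegral.integral_nonneg ht.1.le fun s _ => sq_nonneg _
  set I := ∫ s in (0 : ℝ)..t, ‖ηqt s - ηpt s‖ ^ 2
  have hu := strainNormSq_add_le (u t - Qu t) (Qu t - uh t)
  have hp := gradNormSq_add_le (p t - Qp t) (Qp t - ph t)
  rw [sub_add_sub_cancel] at hu hp
  have hq := norm_sq_sub_le_of_norm_sub_le (q t) (Qq t) (qh t)
  have hX : 0 ≤ μ * strainNormSq (u t - Qu t) := by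
    rw [← norm_sq_strainMap]; positivity
  have hY : 0 ≤ κ * gradNormSq (p t - Qp t) := by
    rw [← norm_sq_gradMap]; positivity
  have hA : 0 ≤ 2 * (c + 4 * μ / b ^ 2 * c) := by positivity
  have hL : 0 < lam⁻¹ := by positivity
  constructor
  · have e1 := mul_le_mul_of_nonneg_left hu hμ.le
    have hS' : 0 ≤ μ * strainNormSq (u t - Qu t) + ‖q t - Qq t‖ ^ 2 := by positivity
    have e2 := mul_nonneg (add_nonneg hA hL.le) hS'
    have e3 := mul_nonneg hL.le hI
    nlinarith [e1, e2, e3, hq, h2, h3, hI]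
  · have e1 := mul_le_mul_of_nonneg_left hp hκ.le
    have e2 := mul_nonneg (add_nonneg hA hL.le) hY
    have e3 := mul_nonneg hA hI
    nlinarith [e1, e2, e3, h1, hI]
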